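/- Setting. Let $2\le p<\infty$ and $c>0$. Let $(Y,d_Y)$ be a complete geodesic metric space which is $p$-uniformly convex with constant $c$: for all $x,y,z\in Y$, every geodesic segment $[y,z]$ and every $t\in[0,1]$, $$d_Y(x,[y,z]_t)^p\le(1-t)\,d_Y(x,y)^p+t\,d_Y(x,z)^p-c^p\,t(1-t)\,d_Y(y,z)^p .$$ For a finitely supported probability measure $\sigma$ on $Y$, let $c_p(\sigma)\in Y$ be its $p$-center of mass, i.e. the unique minimizer of $w\mapsto\big(\int_Y d_Y(u,w)^p\,d\sigma(u)\big)^{1/p}$. Let $\Gamma$ be a group generated by a finite symmetric set $S=S^{-1}\not\ni 1$ with $|S|=2d$, $d\ge 1$, and let $\Gamma$ act on $Y$ by isometries. Let $X$ be the Cayley graph of $\Gamma$ with respect to $S$ (vertex set $\Gamma$, edges $(x,xs)$ with $s\in S$), on which $\Gamma$ acts by left multiplication. A random walk on $X$ is a map $\mu$ assigning to each $x\in X$ a finitely supported probability measure $\mu(x\to\cdot)$ on $X$; its convolution powers are $\mu^{n+1}(x\to\cdot)=\sum_{x'}\mu^n(x\to x')\,\mu(x'\to\cdot)$, $\mu^0(x\to\cdot)=\delta_x$.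 For a $\Gamma$-equivariant random walk $\mu$ and a $\Gamma$-equivariant function $f\colon X\to Y$ put $$E^{(p)}_\mu(f)=\frac12\sum_{x'\in X}\mu(x\to x')\,d_Y(f(x),f(x'))^p\quad(\text{independent of }x\in X),\qquad \big(A^{(p)}_\mu f\big)(x)=c_p\big(f_*\mu(x\to\cdot)\big).$$ Theorem. For all $p\ge2$, $c>0$, $d\ge1$ and every even integer $j\ge0$ there is a constant $C>0$, depending only on $p,c,d,j$, such that for all $\Gamma$, $S$, $Y$ as above, every $\Gamma$-equivariant $f\colon X\to Y$ and every integer $n\ge1$, if $\mu$ denotes the $j$-th convolution power of the standard random walk on $X$ (from $x$ move to $xs$ with $s$ uniform in $S$), then $$E^{(p)}_\mu\big(A^{(p)}_{\mu^n}f\big)\le C\left(\sqrt{\frac{\log n}{n}}\;E^{(p)}_{\mu^n}(f)+\frac1n\,E^{(p)}_\mu(f)\right).$$ -/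

import Mathlib

universe u v

noncomputable section

namespace UniformlyConvexAveraging

/-! ### Uniformly convex geodesic metric spaces -/

/-- `γ : [a, b] → Y` is an isometric embedding with `γ a = y` and `γ b = z`.  (The case `a = b`,
`y = z` is the constant segment; values of `γ` outside `[a, b]` are irrelevant.) -/
structure IsGeodesicSegment {Y : Type*} [MetricSpace Y] (γ : ℝ → Y) (a b : ℝ) (y z : Y) :
    Prop where
  le : a ≤ b
  left : γ a = y
  right : γ b = z
  isometry : ∀ s ∈ Set.Icc a b, ∀ t ∈ Set.Icc a b, dist (γ s) (γ t) = |s - t|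

/-- `Y` is a geodesic metric space that satisfies the `p`-uniform convexity inequality with
constant `c`. -/
structure IsUniformlyConvex (Y : Type*) [MetricSpace Y] (p c : ℝ) : Prop where
  geodesic : ∀ y z : Y, ∃ (γ : ℝ → Y) (a b : ℝ), IsGeodesicSegment γ a b y z
  convex : ∀ (x y z : Y) (γ : ℝ → Y) (a b : ℝ), IsGeodesicSegment γ a b y z →
    ∀ t ∈ Set.Icc (0 : ℝ) 1,
      dist x (γ ((1 - t) * a + t * b)) ^ p ≤
        (1 - t) * dist x y ^ p + t * dist x z ^ p - c ^ p * (t * (1 - t)) * dist y z ^ p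

/-! ### Finitely supported probability measures and the geometric center of mass -/

/-- Finitely supported probability measures on `X`. -/
abbrev FinProb (X : Type*) := Convexity.StdSimplex ℝ X

/-- The integral `∫ g dσ`. -/
def FinProb.integral {X : Type*} (σ : FinProb X) (g : X → ℝ) : ℝ :=
  σ.weights.sum fun x w => w * g x

/-- `d_p(σ, w) = (∫ d(u, w)^p dσ(u))^{1/p}`. -/
def distP {Y : Type*} [MetricSpace Y] (p : ℝ) (σ : FinProb Y) (w : Y) : ℝ :=
  (σ.integral fun u => dist u w ^ p) ^ (1 / p)

/-- The geometric (`p`-)center of mass `c_p(σ)`: the point at which `d_p(σ, ·)` is minimal.  It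
exists and is unique in a complete `p`-uniformly convex space, see
`existsUnique_isCenterOfMass`. -/
def centerOfMass {Y : Type*} [MetricSpace Y] (p : ℝ) (σ : FinProb Y) : Y :=
  @Classical.epsilon Y σ.nonempty fun y => ∀ z, distP p σ y ≤ distP p σ z

/-- In a complete `p`-uniformly convex space, `d_p(σ, ·)` has exactly one minimizer. -/
theorem existsUnique_isCenterOfMass {Y : Type*} [MetricSpace Y] [CompleteSpace Y] {p c : ℝ}
    (hp : 2 ≤ p) (hc : 0 < c) (hY : IsUniformlyConvex Y p c) (σ : FinProb Y) :
    ∃! y : Y, ∀ z, distP p σ y ≤ distP p σ z := by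
  have hp0 : 0 < p := by linarith
  set F : Y → ℝ := fun w => σ.integral fun u => dist u w ^ p with hF
  have hF0 : ∀ w, 0 ≤ F w := fun w =>
    Finset.sum_nonneg fun u _ => mul_nonneg (σ.nonneg u) (Real.rpow_nonneg dist_nonneg _)
  have hle : ∀ y z, distP p σ y ≤ distP p σ z ↔ F y ≤ F z := fun y z =>
    Real.rpow_le_rpow_iff (hF0 y) (hF0 z) (by positivity)
  have hcont : Continuous F := by
    refine continuous_finsetSum _ fun u _ => continuous_const.mul ?_
    exact (continuous_const.dist continuous_id).rpow_const fun _ => Or.inr hp0.le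
  have hmid : ∀ y z, ∃ m, c ^ p * (1 / 4) * dist y z ^ p ≤ F y / 2 + F z / 2 - F m := by
    intro y z
    obtain ⟨γ, a, b, hγ⟩ := hY.geodesic y z
    refine ⟨γ ((1 - 1 / 2) * a + 1 / 2 * b), ?_⟩
    have h := fun u => hY.convex u y z γ a b hγ (1 / 2) ⟨by norm_num, by norm_num⟩
    have h2 : F (γ ((1 - 1 / 2) * a + 1 / 2 * b)) ≤
        ∑ u ∈ σ.weights.support, σ.weights u * ((1 - 1 / 2) * dist u y ^ p
          + 1 / 2 * dist u z ^ p - c ^ p * (1 / 2 * (1 - 1 / 2)) * dist y z ^ p) :=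
      Finset.sum_le_sum fun u _ => mul_le_mul_of_nonneg_left (h u) (σ.nonneg u)
    have h3 : ∑ u ∈ σ.weights.support, σ.weights u = 1 := σ.total
    have h4 : ∑ u ∈ σ.weights.support, σ.weights u * ((1 - 1 / 2) * dist u y ^ p
          + 1 / 2 * dist u z ^ p - c ^ p * (1 / 2 * (1 - 1 / 2)) * dist y z ^ p) =
        F y / 2 + F z / 2 - c ^ p * (1 / 4) * dist y z ^ p := by
      have h5 : ∀ u, σ.weights u * ((1 - 1 / 2) * dist u y ^ p
          + 1 / 2 * dist u z ^ p - c ^ p * (1 / 2 * (1 - 1 / 2)) * dist y z ^ p) =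
          (σ.weights u * dist u y ^ p) * (1 / 2) + (σ.weights u * dist u z ^ p) * (1 / 2)
            - σ.weights u * (c ^ p * (1 / 4) * dist y z ^ p) := fun u => by ring
      simp only [h5, Finset.sum_sub_distrib, Finset.sum_add_distrib, ← Finset.sum_mul, h3]
      simp only [hF, FinProb.integral, Finsupp.sum]
      ring
    linarith
  have hcp : 0 < c ^ p := Real.rpow_pos_of_pos hc p
  have : Nonempty Y := σ.nonempty
  have hbdd : BddBelow (Set.range F) := ⟨0, by rintro _ ⟨w, rfl⟩; exact hF0 w⟩
  set D := ⨅ w, F w with hD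
  have hDle : ∀ w, D ≤ F w := fun w => ciInf_le hbdd w
  have hclose : ∀ y z ε, F y ≤ D + ε → F z ≤ D + ε → dist y z ^ p ≤ 4 / c ^ p * ε := by
    intro y z ε hy hz
    obtain ⟨m, hm⟩ := hmid y z
    have := hDle m
    rw [div_mul_eq_mul_div, le_div_iff₀ hcp]
    nlinarith
  have hex : ∀ n : ℕ, ∃ y, F y < D + 1 / ((n : ℝ) + 1) := fun n =>
    exists_lt_of_ciInf_lt (lt_add_of_pos_right _ (by positivity))
  choose y hy using hex
  have hcauchy : CauchySeq y := by
    rw [Metric.cauchySeq_iff']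
    intro ε hε
    have hεp : 0 < c ^ p / 4 * ε ^ p := by positivity
    obtain ⟨N, hN⟩ := exists_nat_one_div_lt hεp
    refine ⟨N, fun n hn => ?_⟩
    have hmono : 1 / ((n : ℝ) + 1) ≤ 1 / ((N : ℝ) + 1) := by gcongr
    have h := hclose (y n) (y N) (1 / ((N : ℝ) + 1)) (by linarith [hy n]) (hy N).le
    have h' : dist (y n) (y N) ^ p < ε ^ p := by
      refine h.trans_lt ?_
      calc 4 / c ^ p * (1 / ((N : ℝ) + 1)) < 4 / c ^ p * (c ^ p / 4 * ε ^ p) := by gcongr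
        _ = ε ^ p := by field_simp
    exact (Real.rpow_lt_rpow_iff dist_nonneg hε.le hp0).1 h'
  obtain ⟨x, hx⟩ := cauchySeq_tendsto_of_complete hcauchy
  have hxD : F x ≤ D := by
    refine le_of_tendsto_of_tendsto ((hcont.tendsto x).comp hx) ?_
      (Filter.Eventually.of_forall fun n => (hy n).le)
    simpa using tendsto_const_nhds.add (tendsto_one_div_add_atTop_nhds_zero_nat (𝕜 := ℝ))
  refine ⟨x, fun z => (hle x z).2 (hxD.trans (hDle z)), fun w hw => ?_⟩
  have h := hclose w x 0 (by simpa using ((hle w x).1 (hw x)).trans hxD) (by simpa using hxD)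
  by_contra hne
  have := Real.rpow_pos_of_pos (dist_pos.2 hne) p
  linarith

/-! ### Random walks -/

/-- A random walk on `X`: `μ x` is the law `μ(x → ·)` of a step from `x`. -/
abbrev RandomWalk (X : Type*) := X → FinProb X

/-- Convolution powers: `μ^0` is the trivial walk `x ↦ δ_x` and
`μ^{n+1}_x = μ^n_x * μ = ∑ x', μ^n(x → x') μ_{x'}`. -/
def RandomWalk.pow {X : Type*} (μ : RandomWalk X) : ℕ → RandomWalk X
  | 0 => fun x => Convexity.StdSimplex.single x
  | n + 1 => fun x => Convexity.iConvexComb (RandomWalk.pow μ n x) μ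

/-- The standard random walk on the Cayley graph of `Γ` with respect to `S`: from `x` one moves to
`x * s`, with `s` uniform in `S`.  Compare `cayleyWalk_weights`. -/
def cayleyWalk {Γ : Type*} [Group Γ] (S : Finset Γ) (hS : S.Nonempty) : RandomWalk Γ := fun x =>
  { weights := ∑ s ∈ S, Finsupp.single (x * s) ((S.card : ℝ)⁻¹)
    nonneg := Finset.sum_nonneg fun s _ => Finsupp.single_nonneg.2 (by positivity)
    total := by
      have h : (S.card : ℝ) ≠ 0 := by exact_mod_cast hS.card_pos.ne'
      rw [← Finsupp.sum_finsetSum_index (fun _ => rfl) (fun _ _ _ => rfl)]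
      simp [h] }

/-- For a symmetric `S` not containing `1`, the walk moves from `x` to each of its neighbours in
the Cayley graph with probability `1 / |S|`. -/
theorem cayleyWalk_weights {Γ : Type*} [Group Γ] (S : Finset Γ) (hS : S.Nonempty)
    (hsymm : ∀ s ∈ S, s⁻¹ ∈ S) (hone : (1 : Γ) ∉ S) (x y : Γ) [Decidable
      ((SimpleGraph.mulCayley (S : Set Γ)).Adj x y)] :
    (cayleyWalk S hS x).weights y =
      if (SimpleGraph.mulCayley (S : Set Γ)).Adj x y then (S.card : ℝ)⁻¹ else 0 := by
  classical
  have h1 : (SimpleGraph.mulCayley (S : Set Γ)).Adj x y ↔ x⁻¹ * y ∈ S := by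
    rw [SimpleGraph.mulCayley_adj']
    constructor
    · rintro ⟨-, g, hg, rfl | rfl⟩
      · simpa using hg
      · simpa using hsymm g hg
    · intro h
      refine ⟨?_, _, h, Or.inl (by simp)⟩
      rintro rfl
      simp [hone] at h
  have h2 : ∀ s : Γ, x * s = y ↔ s = x⁻¹ * y := fun s => by rw [eq_inv_mul_iff_mul_eq]
  simp [cayleyWalk, Finsupp.single_apply, h1, h2]

/-! ### Energy and averaging of equivariant functions on the Cayley graph -/

/-- The gradient `|∇_μ f|_p(x) = (∫ d(f x, f x')^p dμ(x → x'))^{1/p}`. -/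
def gradP {X Y : Type*} [MetricSpace Y] (p : ℝ) (μ : RandomWalk X) (f : X → Y) (x : X) : ℝ :=
  ((μ x).integral fun x' => dist (f x) (f x') ^ p) ^ (1 / p)

/-- The energy `E_μ^{(p)}(f)`: half of the integral of `|∇_μ f|_p^p` over `Γ \ X`.  Here `X` is the
vertex set `Γ` of the Cayley graph, so `Γ \ X` is one point with its only probability measure, and
the integral is the value of the `Γ`-invariant function `|∇_μ f|_p^p` at the vertex `1`
(or at any other vertex). -/
def energy {Γ Y : Type*} [Group Γ] [MetricSpace Y] (p : ℝ) (μ : RandomWalk Γ) (f : Γ → Y) : ℝ :=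
  (1 / 2) * gradP p μ f 1 ^ p

/-- The `p`-barycentric average `(A_μ^{(p)} f)(x) = c_p(f_* μ_x)`. -/
def average {X Y : Type*} [MetricSpace Y] (p : ℝ) (μ : RandomWalk X) (f : X → Y) : X → Y :=
  fun x => centerOfMass p ((μ x).map f)

/-- `f : Γ → Y` is equivariant for left translation on the vertices of the Cayley graph. -/
def IsEquivariant {Γ Y : Type*} [Group Γ] [MulAction Γ Y] (f : Γ → Y) : Prop :=
  ∀ g x : Γ, f (g * x) = g • f x

/-- For an equivariant walk and an equivariant function the gradient is `Γ`-invariant, so the choice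
of the vertex in `energy` does not matter. -/
theorem gradP_mul {Γ Y : Type*} [Group Γ] [MetricSpace Y] [MulAction Γ Y] [IsIsometricSMul Γ Y]
    (p : ℝ) (μ : RandomWalk Γ) (hμ : ∀ g x, μ (g * x) = (μ x).map (g * ·)) (f : Γ → Y)
    (hf : IsEquivariant f) (g x : Γ) : gradP p μ f (g * x) = gradP p μ f x := by
  simp only [gradP, FinProb.integral, hμ, Convexity.StdSimplex.weights_map]
  rw [Finsupp.sum_mapDomain_index (fun _ => zero_mul _) (fun _ _ _ => add_mul _ _ _)]
  simp only [hf g, dist_smul]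

end UniformlyConvexAveraging

end

open UniformlyConvexAveraging

namespace UniformlyConvexAveraging

/-! Let `P` be the averaging operator of `μ`, `A` the average of `f` under `μ^n`, and `G z = d(A 1,
f z)^p`. Uniform convexity sharpens minimality of a center of mass: moving away from it by `D`
raises the integral by at least `c^p D^p` (`integral_dist_centerOfMass_add_le`). Comparing `A 1`
with the center `A x` at a random neighbour `x` of `1` gives `2 c^p E_μ(A) ≤ P^(n+1) G 1 - P^n G 1`
(`energy_average_le`), so the task is to bound the effect of one extra step.

As `j` is even, `μ` stays put with probability at least `ε = (2d)^(-j)`. So `P = (1 - ε) K + ε` with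
`K` Markov, and `P^n` is a binomial mixture of the powers `K^k`. The mixtures for `n` and `n + 1`
have weight ratio at most `1 + O(√(log n / n))` outside a tail of mass `n^(-p-1)`
(`exists_sum_binomialWeight_succ_le`). On the tail, `K^k G` is `O(n^p E_μ(f))`, which leaves the
`1/n` term. Finally `P^n G 1 ≤ 2 E_{μ^n}(f)`, because `A 1` is a minimizer and `f 1` a competitor.
-/

/-! ### Comparing consecutive binomial distributions -/

/-- The weight of the binomial distribution with `n` trials at `k`, where a trial fails with
probability `ε`. -/
noncomputable def binomialWeight (ε : ℝ) (n k : ℕ) : ℝ :=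
  (1 - ε) ^ k * ε ^ (n - k) * n.choose k

theorem binomialWeight_nonneg {ε : ℝ} (h0 : 0 < ε) (h1 : ε < 1) (n k : ℕ) :
    0 ≤ binomialWeight ε n k := by
  have : 0 < 1 - ε := by linarith
  unfold binomialWeight
  positivity

theorem sum_binomialWeight (ε : ℝ) (n : ℕ) :
    ∑ k ∈ Finset.range (n + 1), binomialWeight ε n k = 1 := by
  have h := add_pow (1 - ε) ε n
  simp only [sub_add_cancel, one_pow] at h
  exact h.symm

theorem sum_binomialWeight_mul_exp (ε η : ℝ) (n : ℕ) :
    ∑ k ∈ Finset.range (n + 1), binomialWeight ε n k * Real.exp (-η * ((n : ℝ) - k)) =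
      (1 - ε + ε * Real.exp (-η)) ^ n := by
  rw [add_pow]
  refine Finset.sum_congr rfl fun k hk => ?_
  have hk' : k ≤ n := Nat.lt_succ_iff.1 (Finset.mem_range.1 hk)
  rw [binomialWeight, mul_pow, ← Real.exp_nat_mul, Nat.cast_sub hk', mul_comm (-η)]
  ring

/-- Adding a trial increases a weight at most by a factor close to `1`, unless the number of
failures is far below its mean. -/
theorem binomialWeight_succ_le {ε l : ℝ} (h0 : 0 < ε) (h1 : ε < 1) (hl0 : 0 ≤ l) (hl : l ≤ 1 / 2)
    {n k : ℕ} (hk : k ≤ n + 1) :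
    binomialWeight ε (n + 1) k ≤ (1 + 2 * l) * binomialWeight ε n k +
      binomialWeight ε (n + 1) k * Real.exp (-(l / 2) * (((n + 1 : ℕ) : ℝ) - k)) *
        Real.exp (l / 2 * (((n + 1 : ℕ) : ℝ) * ε * (1 - l))) := by
  have hb := binomialWeight_nonneg h0 h1 n k
  have hB := binomialWeight_nonneg h0 h1 (n + 1) k
  have hN : (0 : ℝ) < ((n + 1 : ℕ) : ℝ) := by positivity
  -- The ratio of the two weights is `(n+1)ε / (n+1-k)`: the mean number of failures over the actual
  -- number.
  rcases le_or_gt (((n + 1 : ℕ) : ℝ) * ε * (1 - l)) (((n + 1 : ℕ) : ℝ) - k) with h | h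
  · have hpos : 0 < ((n + 1 : ℕ) : ℝ) - k := by
      refine lt_of_lt_of_le ?_ h
      have : 0 < 1 - l := by linarith
      positivity
    have hkn : k ≤ n := by
      have : (k : ℝ) < ((n + 1 : ℕ) : ℝ) := by linarith
      exact Nat.lt_succ_iff.1 (by exact_mod_cast this)
    have hc : ((n.choose k : ℕ) : ℝ) * ((n + 1 : ℕ) : ℝ) =
        ((n + 1).choose k : ℝ) * (((n + 1 : ℕ) : ℝ) - k) := by
      have := Nat.choose_mul_succ_eq n k
      rw [← Nat.cast_sub hk]
      exact_mod_cast this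
    have he : binomialWeight ε (n + 1) k * (((n + 1 : ℕ) : ℝ) - k) =
        binomialWeight ε n k * (((n + 1 : ℕ) : ℝ) * ε) := by
      have hp : ε ^ (n + 1 - k) = ε ^ (n - k) * ε := by
        rw [Nat.sub_add_comm hkn, pow_succ]
      rw [binomialWeight, binomialWeight, mul_assoc, ← hc, hp]
      ring
    have hle : ((n + 1 : ℕ) : ℝ) * ε ≤ (1 + 2 * l) * (((n + 1 : ℕ) : ℝ) - k) := by
      have h2 : 1 ≤ (1 + 2 * l) * (1 - l) := by nlinarith
      calc ((n + 1 : ℕ) : ℝ) * ε ≤ ((n + 1 : ℕ) : ℝ) * ε * ((1 + 2 * l) * (1 - l)) :=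
            le_mul_of_one_le_right (by positivity) h2
        _ = (1 + 2 * l) * (((n + 1 : ℕ) : ℝ) * ε * (1 - l)) := by ring
        _ ≤ _ := by gcongr
    have hmain : binomialWeight ε (n + 1) k ≤ (1 + 2 * l) * binomialWeight ε n k := by
      refine le_of_mul_le_mul_right ?_ hpos
      rw [he]
      calc binomialWeight ε n k * (((n + 1 : ℕ) : ℝ) * ε)
          ≤ binomialWeight ε n k * ((1 + 2 * l) * (((n + 1 : ℕ) : ℝ) - k)) := by gcongr
        _ = _ := by ring
    have : 0 ≤ binomialWeight ε (n + 1) k * Real.exp (-(l / 2) * (((n + 1 : ℕ) : ℝ) - k)) *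
        Real.exp (l / 2 * (((n + 1 : ℕ) : ℝ) * ε * (1 - l))) := by positivity
    linarith
  -- Few failures: the combined exponential is at least `1`, so the Chernoff term alone dominates.
  · rw [mul_assoc, ← Real.exp_add]
    have : (1 : ℝ) ≤ Real.exp (-(l / 2) * (((n + 1 : ℕ) : ℝ) - k) +
        l / 2 * (((n + 1 : ℕ) : ℝ) * ε * (1 - l))) := by
      rw [Real.one_le_exp_iff]
      nlinarith
    have h3 := le_mul_of_one_le_right hB this
    have : 0 ≤ (1 + 2 * l) * binomialWeight ε n k := by positivity
    linarith

theorem exp_neg_le_one_sub_add_sq {η : ℝ} (hη : 0 ≤ η) : Real.exp (-η) ≤ 1 - η + η ^ 2 := by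
  have h1 : 1 + η ≤ Real.exp η := by linarith [Real.add_one_le_exp η]
  have h2 : Real.exp (-η) * (1 + η) ≤ 1 := by
    calc Real.exp (-η) * (1 + η) ≤ Real.exp (-η) * Real.exp η := by gcongr
      _ = 1 := by rw [← Real.exp_add]; simp
  have h3 : 1 ≤ (1 - η + η ^ 2) * (1 + η) := by nlinarith [pow_nonneg hη 3]
  exact le_of_mul_le_mul_right (h2.trans h3) (by linarith)

/-- Chernoff bound for the lower tail. With parameter `η` the exponent is `nε(η² - ηl)`, and `η =
l/2` minimizes it. -/
theorem sum_binomialWeight_tail_le {ε l : ℝ} (h0 : 0 < ε) (h1 : ε < 1) (hl0 : 0 ≤ l) (n : ℕ) :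
    (∑ k ∈ Finset.range (n + 1), binomialWeight ε n k * Real.exp (-(l / 2) * ((n : ℝ) - k))) *
        Real.exp (l / 2 * ((n : ℝ) * ε * (1 - l))) ≤ Real.exp (-(n * ε * l ^ 2 / 4)) := by
  rw [sum_binomialWeight_mul_exp]
  have hb : 1 - ε + ε * Real.exp (-(l / 2)) ≤ Real.exp (ε * (-(l / 2) + (l / 2) ^ 2)) := by
    have h2 := exp_neg_le_one_sub_add_sq (η := l / 2) (by linarith)
    have h3 := Real.add_one_le_exp (ε * (-(l / 2) + (l / 2) ^ 2))
    nlinarith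
  have hb0 : 0 ≤ 1 - ε + ε * Real.exp (-(l / 2)) := by
    have := Real.exp_pos (-(l / 2))
    have : 0 < ε * Real.exp (-(l / 2)) := by positivity
    linarith
  calc _ ≤ Real.exp (ε * (-(l / 2) + (l / 2) ^ 2)) ^ n *
        Real.exp (l / 2 * ((n : ℝ) * ε * (1 - l))) := by gcongr
    _ = _ := by
      rw [← Real.exp_nat_mul, ← Real.exp_add]
      congr 1
      ring

theorem tendsto_sqrt_log_div_nat :
    Filter.Tendsto (fun n : ℕ => Real.sqrt (Real.log n / n)) Filter.atTop (nhds 0) := by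
  have h := Real.isLittleO_log_id_atTop.tendsto_div_nhds_zero.comp tendsto_natCast_atTop_atTop
  have h2 := (Real.continuous_sqrt.tendsto 0).comp h
  simpa [Function.comp_def] using h2

/-- Take `l = a √(log n / n)` in the two preceding estimates. The logarithm is the price of a tail
of polynomial size `n^(-r)`; the power `r` affects only `a`. -/
theorem exists_sum_binomialWeight_succ_le {ε : ℝ} (h0 : 0 < ε) (h1 : ε < 1) {r : ℝ} (hr : 0 < r) :
    ∃ C : ℝ, 0 < C ∧ ∀ n : ℕ, 1 ≤ n → ∀ (m : ℕ → ℝ) (M : ℝ), (∀ k, 0 ≤ m k) →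
      (∀ k ≤ n + 1, m k ≤ M) →
      ∑ k ∈ Finset.range (n + 2), binomialWeight ε (n + 1) k * m k ≤
        (1 + C * Real.sqrt (Real.log n / n)) *
          ∑ k ∈ Finset.range (n + 1), binomialWeight ε n k * m k + C * ((n : ℝ) ^ r)⁻¹ * M := by
  -- Chosen so that `nεl²/4 = r log n`.
  set a : ℝ := Real.sqrt (4 * r / ε) with ha
  have ha0 : 0 ≤ a := Real.sqrt_nonneg _
  have ha2 : a ^ 2 = 4 * r / ε := Real.sq_sqrt (by positivity)
  obtain ⟨n₀, hn₀⟩ : ∃ n₀ : ℕ, ∀ n ≥ n₀, a * Real.sqrt (Real.log n / n) ≤ 1 / 2 := by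
    have h := (tendsto_sqrt_log_div_nat.const_mul a).eventually_le_const
      (u := 1 / 2) (by norm_num)
    exact Filter.eventually_atTop.1 h
  -- `2a` comes from the factor `1 + 2l`, `n₀^r` covers the small `n` where `l ≤ 1/2` may fail, and
  -- `1` covers the tail.
  refine ⟨2 * a + (n₀ : ℝ) ^ r + 1, by positivity, fun n hn m M hm hmM => ?_⟩
  set C : ℝ := 2 * a + (n₀ : ℝ) ^ r + 1 with hC
  have hn0 : (0 : ℝ) < n := by exact_mod_cast hn
  have hM : 0 ≤ M := (hm 0).trans (hmM 0 (by omega))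
  have hr0 : 0 < (n : ℝ) ^ r := by positivity
  have hn₀r : 0 ≤ (n₀ : ℝ) ^ r := by positivity
  set S := ∑ k ∈ Finset.range (n + 1), binomialWeight ε n k * m k with hS
  have hS0 : 0 ≤ S := Finset.sum_nonneg fun k _ =>
    mul_nonneg (binomialWeight_nonneg h0 h1 n k) (hm k)
  set q := Real.sqrt (Real.log n / n) with hq
  have hq0 : 0 ≤ q := Real.sqrt_nonneg _
  rcases lt_or_ge n n₀ with hlt | hge
  · have h2 : ∑ k ∈ Finset.range (n + 2), binomialWeight ε (n + 1) k * m k ≤ M := by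
      calc _ ≤ ∑ k ∈ Finset.range (n + 2), binomialWeight ε (n + 1) k * M := by
            refine Finset.sum_le_sum fun k hk => ?_
            exact mul_le_mul_of_nonneg_left (hmM k (Nat.lt_succ_iff.1 (Finset.mem_range.1 hk)))
              (binomialWeight_nonneg h0 h1 _ _)
        _ = M := by rw [← Finset.sum_mul, sum_binomialWeight, one_mul]
    have h3 : 1 ≤ C * ((n : ℝ) ^ r)⁻¹ := by
      rw [← div_eq_mul_inv, le_div_iff₀ hr0, one_mul]
      have : (n : ℝ) ^ r ≤ (n₀ : ℝ) ^ r := by gcongr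
      linarith
    have h4 := le_mul_of_one_le_left hM h3
    have : 0 ≤ (1 + C * q) * S := by positivity
    linarith
  · have hl := hn₀ n hge
    rw [← hq] at hl
    have hl0 : 0 ≤ a * q := by positivity
    set E := Real.exp (a * q / 2 * (((n + 1 : ℕ) : ℝ) * ε * (1 - a * q))) with hE
    have hsum : ∑ k ∈ Finset.range (n + 2), binomialWeight ε (n + 1) k * m k ≤
        ∑ k ∈ Finset.range (n + 2), ((1 + 2 * (a * q)) * (binomialWeight ε n k * m k) +
          binomialWeight ε (n + 1) k *
            Real.exp (-(a * q / 2) * (((n + 1 : ℕ) : ℝ) - k)) * (E * M)) := by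
      refine Finset.sum_le_sum fun k hk => ?_
      have hk' : k ≤ n + 1 := Nat.lt_succ_iff.1 (Finset.mem_range.1 hk)
      have hB := binomialWeight_nonneg h0 h1 (n + 1) k
      calc _ ≤ ((1 + 2 * (a * q)) * binomialWeight ε n k + binomialWeight ε (n + 1) k *
            Real.exp (-(a * q / 2) * (((n + 1 : ℕ) : ℝ) - k)) * E) * m k :=
            mul_le_mul_of_nonneg_right (binomialWeight_succ_le h0 h1 hl0 hl hk') (hm k)
        _ = (1 + 2 * (a * q)) * (binomialWeight ε n k * m k) + binomialWeight ε (n + 1) k *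
            Real.exp (-(a * q / 2) * (((n + 1 : ℕ) : ℝ) - k)) * (E * m k) := by ring
        _ ≤ _ := by gcongr; exact hmM k hk'
    have hlast : binomialWeight ε n (n + 1) = 0 := by simp [binomialWeight]
    rw [Finset.sum_add_distrib, ← Finset.mul_sum, ← Finset.sum_mul,
      Finset.sum_range_succ (fun k => binomialWeight ε n k * m k) (n + 1), hlast, zero_mul, add_zero, ← hS, ← mul_assoc] at hsum
    have htail : Real.exp (-(((n + 1 : ℕ) : ℝ) * ε * (a * q) ^ 2 / 4)) ≤ ((n : ℝ) ^ r)⁻¹ := by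
      rw [← Real.rpow_neg hn0.le, Real.rpow_def_of_pos hn0, Real.exp_le_exp]
      have hlog : 0 ≤ Real.log n := Real.log_nonneg (by exact_mod_cast hn)
      have hq2 : q ^ 2 = Real.log n / n := Real.sq_sqrt (by positivity)
      rw [mul_pow, ha2, hq2]
      have he : ((n + 1 : ℕ) : ℝ) * ε * (4 * r / ε * (Real.log n / n)) / 4 =
          Real.log n * r + Real.log n * r / n := by
        push_cast
        field_simp
      rw [he]
      have : 0 ≤ Real.log n * r / n := by positivity
      linarith
    have h5 := (sum_binomialWeight_tail_le h0 h1 hl0 (n + 1)).trans htail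
    have h6 := mul_le_mul_of_nonneg_right h5 hM
    have h7 : (1 + 2 * (a * q)) * S ≤ (1 + C * q) * S := by
      refine mul_le_mul_of_nonneg_right ?_ hS0
      nlinarith
    have h8 : ((n : ℝ) ^ r)⁻¹ * M ≤ C * ((n : ℝ) ^ r)⁻¹ * M := by
      rw [mul_assoc]
      exact le_mul_of_one_le_left (by positivity) (by linarith)
    linarith

/-! ### Markov operators -/

/-- A positive linear operator on functions that fixes the constants. -/
structure IsMarkov {X : Type*} (P : Module.End ℝ (X → ℝ)) : Prop where
  nonneg : ∀ g : X → ℝ, 0 ≤ g → 0 ≤ P g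
  one : P 1 = 1

namespace IsMarkov

variable {X : Type*} {P : Module.End ℝ (X → ℝ)}

theorem mono (hP : IsMarkov P) {g h : X → ℝ} (hgh : g ≤ h) : P g ≤ P h := by
  have := hP.nonneg (h - g) (sub_nonneg.2 hgh)
  rw [map_sub] at this
  exact sub_nonneg.1 this

theorem pow (hP : IsMarkov P) (n : ℕ) : IsMarkov (P ^ n) := by
  induction n with
  | zero => exact ⟨fun g hg => by simpa using hg, by simp⟩
  | succ n ih =>
    refine ⟨fun g hg => ?_, ?_⟩
    · rw [pow_succ', Module.End.mul_apply]
      exact hP.nonneg _ (ih.nonneg g hg)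
    · rw [pow_succ', Module.End.mul_apply, ih.one, hP.one]

theorem const (hP : IsMarkov P) (c : ℝ) : P (fun _ => c) = fun _ => c := by
  have h : (fun _ : X => c) = c • 1 := by ext; simp
  rw [h, map_smul, hP.one]

theorem apply_le_mul_add (hP : IsMarkov P) {g h : X → ℝ} {α β : ℝ}
    (hgh : ∀ z, g z ≤ α * h z + β) (x : X) : P g x ≤ α * P h x + β := by
  have h1 := hP.mono (show g ≤ α • h + fun _ => β from hgh) x
  rw [map_add, map_smul, hP.const] at h1
  exact h1

end IsMarkov

/-- Convexity of `x^p` with weights `t/(t+1)` and `1/(t+1)`. They are tuned so that `a^p ≤ t^p M`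
and `b^p ≤ M` give exactly `(t+1)^p M`, which replaces Minkowski's inequality in the moment
induction. -/
theorem add_rpow_le {p a b t : ℝ} (hp : 1 ≤ p) (ha : 0 ≤ a) (hb : 0 ≤ b) (ht : 0 < t) :
    (a + b) ^ p ≤ t / (t + 1) * ((t + 1) / t) ^ p * a ^ p + 1 / (t + 1) * (t + 1) ^ p * b ^ p := by
  have h := (convexOn_rpow hp).2 (show (t + 1) / t * a ∈ Set.Ici 0 from Set.mem_Ici.2 (by positivity))
    (show (t + 1) * b ∈ Set.Ici 0 from Set.mem_Ici.2 (by positivity))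
    (show 0 ≤ t / (t + 1) by positivity) (show 0 ≤ 1 / (t + 1) by positivity) (by field_simp)
  simp only [smul_eq_mul] at h
  rw [Real.mul_rpow (by positivity) ha, Real.mul_rpow (by positivity) hb] at h
  have e : t / (t + 1) * ((t + 1) / t * a) + 1 / (t + 1) * ((t + 1) * b) = a + b := by
    field_simp
  rw [e] at h
  linarith

theorem add_rpow_le_two_rpow {p a b : ℝ} (hp : 1 ≤ p) (ha : 0 ≤ a) (hb : 0 ≤ b) :
    (a + b) ^ p ≤ 2 ^ p * (a ^ p + b ^ p) := by
  have h := add_rpow_le hp ha hb one_pos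
  norm_num at h
  have : 0 ≤ (2 : ℝ) ^ p * a ^ p := by positivity
  have : 0 ≤ (2 : ℝ) ^ p * b ^ p := by positivity
  linarith

/-! ### Displacement moments and lazy Markov operators -/

section Moments

variable {X Y : Type*} [MetricSpace Y] {p : ℝ}

/-- The `p`-th moment of the displacement grows at most like `k ^ p` along a Markov chain. -/
theorem IsMarkov.pow_dist_rpow_le {K : Module.End ℝ (X → ℝ)} (hK : IsMarkov K) (hp : 1 ≤ p)
    (f : X → Y) {M : ℝ} (hM : ∀ x, K (fun z => dist (f x) (f z) ^ p) x ≤ M) (k : ℕ) (x : X) :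
    (K ^ k) (fun z => dist (f x) (f z) ^ p) x ≤ (k : ℝ) ^ p * M := by
  have hp0 : p ≠ 0 := by linarith
  induction k with
  | zero => simp [Real.zero_rpow hp0]
  | succ k ih =>
    rcases Nat.eq_zero_or_pos k with rfl | hk
    · simpa using hM x
    have ht : (0 : ℝ) < k := by exact_mod_cast hk
    generalize htdef : (k : ℝ) = t at ih ht
    have ht1 : 0 < t + 1 := by linarith
    have hstep : ∀ z, K (fun y => dist (f x) (f y) ^ p) z ≤
        t / (t + 1) * ((t + 1) / t) ^ p * dist (f x) (f z) ^ p +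
          1 / (t + 1) * (t + 1) ^ p * M := by
      intro z
      -- Here `z` is the position after `k` steps and `y` the position after one more.
      have h1 := hK.apply_le_mul_add (g := fun y => dist (f x) (f y) ^ p)
        (h := fun y => dist (f z) (f y) ^ p) (α := 1 / (t + 1) * (t + 1) ^ p)
        (β := t / (t + 1) * ((t + 1) / t) ^ p * dist (f x) (f z) ^ p) (fun y => ?_) z
      · have h2 : 1 / (t + 1) * (t + 1) ^ p * K (fun y => dist (f z) (f y) ^ p) z ≤
            1 / (t + 1) * (t + 1) ^ p * M := by
          have := hM z
          gcongr
        linarith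
      · have h3 := add_rpow_le hp (dist_nonneg (x := f x) (y := f z))
          (dist_nonneg (x := f z) (y := f y)) ht
        have h4 : dist (f x) (f y) ^ p ≤ (dist (f x) (f z) + dist (f z) (f y)) ^ p :=
          Real.rpow_le_rpow dist_nonneg (dist_triangle _ _ _) (by linarith)
        linarith
    rw [pow_succ, Module.End.mul_apply]
    have h5 := (hK.pow k).apply_le_mul_add hstep x
    refine h5.trans ?_
    have h6 : t / (t + 1) * ((t + 1) / t) ^ p * (K ^ k) (fun z => dist (f x) (f z) ^ p) x ≤
        t / (t + 1) * ((t + 1) / t) ^ p * (t ^ p * M) := by gcongr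
    have h7 : t / (t + 1) * ((t + 1) / t) ^ p * (t ^ p * M) +
        1 / (t + 1) * (t + 1) ^ p * M = (t + 1) ^ p * M := by
      rw [Real.div_rpow ht1.le ht.le]
      have : t ^ p ≠ 0 := by positivity
      field_simp
    rw [Nat.cast_succ, htdef]
    linarith

/-- Removing holding mass `ε` keeps the operator positive, and renormalizing restores the constants.
-/
theorem IsMarkov.of_lazy {P : Module.End ℝ (X → ℝ)} (hP : IsMarkov P) {ε : ℝ} (h1 : ε < 1)
    (hε : ∀ g : X → ℝ, 0 ≤ g → ε • g ≤ P g) : IsMarkov ((1 - ε)⁻¹ • (P - ε • 1)) := by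
  have h : 0 < 1 - ε := by linarith
  refine ⟨fun g hg => ?_, ?_⟩
  · rw [LinearMap.smul_apply]
    refine smul_nonneg (by positivity) ?_
    simpa using hε g hg
  · simp only [LinearMap.smul_apply, LinearMap.sub_apply, hP.one, Module.End.one_apply]
    ext x
    simp
    field_simp

/-- `K` commutes with the identity, so the binomial theorem applies: `n` lazy steps are a binomial
number of `K`-steps. -/
theorem lazy_pow_apply {K P : Module.End ℝ (X → ℝ)} {ε : ℝ}
    (h : P = (1 - ε) • K + ε • 1) (n : ℕ) (g : X → ℝ) (x : X) :
    (P ^ n) g x = ∑ k ∈ Finset.range (n + 1), binomialWeight ε n k * (K ^ k) g x := by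
  have hc : Commute ((1 - ε) • K) (ε • (1 : Module.End ℝ (X → ℝ))) :=
    ((Commute.one_right K).smul_right ε).smul_left (1 - ε)
  rw [h, hc.add_pow, LinearMap.sum_apply, Finset.sum_apply]
  refine Finset.sum_congr rfl fun k _ => ?_
  rw [binomialWeight, smul_pow, smul_pow, one_pow, ← nsmul_eq_mul', smul_mul_smul_comm, mul_one,
    ← Nat.cast_smul_eq_nsmul ℝ, smul_smul, mul_comm (n.choose k : ℝ)]
  rfl

theorem exists_lazy_pow_succ_le (hp : 1 ≤ p) {ε : ℝ} (h0 : 0 < ε) (h1 : ε < 1) :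
    ∃ C : ℝ, 0 < C ∧ ∀ (X : Type u) (Y : Type v) [MetricSpace Y] (P : Module.End ℝ (X → ℝ)),
      IsMarkov P → (∀ g : X → ℝ, 0 ≤ g → ε • g ≤ P g) →
      ∀ (f : X → Y) (M : ℝ), (∀ x, P (fun z => dist (f x) (f z) ^ p) x ≤ M) →
      ∀ n : ℕ, 1 ≤ n → ∀ (w : Y) (x : X),
        (P ^ n) (fun z => dist w (f z) ^ p) x ≤ (P ^ n) (fun z => dist (f x) (f z) ^ p) x →
        (P ^ (n + 1)) (fun z => dist w (f z) ^ p) x ≤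
          (P ^ n) (fun z => dist w (f z) ^ p) x + C * (Real.sqrt (Real.log n / n) *
            (P ^ n) (fun z => dist (f x) (f z) ^ p) x + 1 / n * M) := by
  -- The tail `n^(-p-1)` absorbs the moment growth `n^p` and leaves `1/n`.
  obtain ⟨C, hC, hbin⟩ := exists_sum_binomialWeight_succ_le h0 h1 (r := p + 1) (by linarith)
  have hε1 : 0 < 1 - ε := by linarith
  set B : ℝ := 2 ^ p * (2 ^ p * (2 + (1 - ε)⁻¹)) * 2 ^ p with hB
  have hB0 : 0 < B := by positivity
  refine ⟨C + C * B, by positivity, ?_⟩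
  intro X Y _ P hP hε f M hM n hn w x hw
  set K : Module.End ℝ (X → ℝ) := (1 - ε)⁻¹ • (P - ε • 1) with hKdef
  have hK : IsMarkov K := hP.of_lazy h1 hε
  have hPK : P = (1 - ε) • K + ε • 1 := by
    rw [hKdef, smul_inv_smul₀ hε1.ne', sub_add_cancel]
  have hpow0 : ∀ u v : Y, 0 ≤ dist u v ^ p := fun u v => Real.rpow_nonneg dist_nonneg p
  have hn0 : (0 : ℝ) < n := by exact_mod_cast hn
  have hM0 : 0 ≤ M := (hP.nonneg _ (fun z => hpow0 (f x) (f z)) x).trans (hM x)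
  -- Staying put contributes no displacement, so passing from `P` to `K` only costs the
  -- normalization.
  have hKM : ∀ z, K (fun y => dist (f z) (f y) ^ p) z ≤ (1 - ε)⁻¹ * M := by
    intro z
    have hp0 : p ≠ 0 := by linarith
    simp only [hKdef, LinearMap.smul_apply, LinearMap.sub_apply, Module.End.one_apply,
      Pi.smul_apply, Pi.sub_apply, smul_eq_mul, dist_self, Real.zero_rpow hp0, mul_zero, sub_zero]
    have := hM z
    gcongr
  have htri : ∀ a b c : Y, dist a c ^ p ≤ 2 ^ p * (dist a b ^ p + dist b c ^ p) := fun a b c =>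
    (Real.rpow_le_rpow dist_nonneg (dist_triangle _ _ _) (by linarith)).trans
      (add_rpow_le_two_rpow hp dist_nonneg dist_nonneg)
  set F := (P ^ n) (fun z => dist (f x) (f z) ^ p) x with hF
  set G := (P ^ n) (fun z => dist w (f z) ^ p) x with hG
  have hFle : F ≤ (n : ℝ) ^ p * M := hP.pow_dist_rpow_le hp f hM n x
  -- Average the triangle inequality through `f z` under `P^n`, using `G ≤ F`.
  have hdist : dist w (f x) ^ p ≤ 2 ^ p * (2 * ((n : ℝ) ^ p * M)) := by
    have h2 := (hP.pow n).apply_le_mul_add (g := fun _ => dist w (f x) ^ p)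
      (h := (fun z => dist w (f z) ^ p) + fun z => dist (f x) (f z) ^ p)
      (α := 2 ^ p) (β := 0) (fun z => by
        have := htri w (f z) (f x)
        rw [dist_comm (f z)] at this
        simpa using this) x
    rw [(hP.pow n).const, map_add, Pi.add_apply, add_zero] at h2
    refine h2.trans ?_
    gcongr
    linarith
  have hn1 : ((n : ℝ) + 1) ^ p ≤ 2 ^ p * (n : ℝ) ^ p := by
    rw [← Real.mul_rpow (by norm_num) hn0.le]
    refine Real.rpow_le_rpow (by positivity) ?_ (by linarith)
    have : (1 : ℝ) ≤ n := by exact_mod_cast hn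
    linarith
  have hnn : (n : ℝ) ^ p ≤ ((n : ℝ) + 1) ^ p :=
    Real.rpow_le_rpow hn0.le (by linarith) (by linarith)
  have hm : ∀ k ≤ n + 1, (K ^ k) (fun z => dist w (f z) ^ p) x ≤ B * (n : ℝ) ^ p * M := by
    intro k hk
    have h3 := (hK.pow k).apply_le_mul_add (g := fun z => dist w (f z) ^ p)
      (h := fun z => dist (f x) (f z) ^ p)
      (α := 2 ^ p) (β := 2 ^ p * dist w (f x) ^ p) (fun z => by
        have := htri w (f x) (f z)
        linarith) x
    have h4 := hK.pow_dist_rpow_le hp f hKM k x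
    have h5 : (k : ℝ) ^ p ≤ ((n : ℝ) + 1) ^ p := by
      refine Real.rpow_le_rpow (by positivity) ?_ (by linarith)
      exact_mod_cast hk
    have h2p : (1 : ℝ) ≤ 2 ^ p := Real.one_le_rpow (by norm_num) (by linarith)
    calc _ ≤ 2 ^ p * (K ^ k) (fun z => dist (f x) (f z) ^ p) x + 2 ^ p * dist w (f x) ^ p := h3
      _ ≤ 2 ^ p * ((2 ^ p * (n : ℝ) ^ p) * ((1 - ε)⁻¹ * M)) +
          2 ^ p * (2 ^ p * (2 * ((n : ℝ) ^ p * M))) := by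
        gcongr
        refine h4.trans ?_
        gcongr
        exact h5.trans hn1
      _ = 2 ^ p * (2 ^ p * (2 + (1 - ε)⁻¹)) * ((n : ℝ) ^ p * M) := by ring
      _ ≤ 2 ^ p * (2 ^ p * (2 + (1 - ε)⁻¹)) * 2 ^ p * ((n : ℝ) ^ p * M) := by
        refine mul_le_mul_of_nonneg_right ?_ (by positivity)
        exact le_mul_of_one_le_right (by positivity) h2p
      _ = _ := by rw [hB]; ring
  have hfin := hbin n hn (fun k => (K ^ k) (fun z => dist w (f z) ^ p) x) (B * (n : ℝ) ^ p * M)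
    (fun k => (hK.pow k).nonneg _ (fun z => hpow0 w (f z)) x) hm
  rw [← lazy_pow_apply hPK n, ← lazy_pow_apply hPK (n + 1), ← hG] at hfin
  have he : C * ((n : ℝ) ^ (p + 1))⁻¹ * (B * (n : ℝ) ^ p * M) = C * B * (1 / n * M) := by
    rw [Real.rpow_add_one hn0.ne']
    have : (n : ℝ) ^ p ≠ 0 := by positivity
    field_simp
  rw [he] at hfin
  have hq0 : 0 ≤ Real.sqrt (Real.log n / n) := Real.sqrt_nonneg _
  have hF0 : 0 ≤ F := (hP.pow n).nonneg _ (fun z => hpow0 (f x) (f z)) x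
  set q := Real.sqrt (Real.log n / n)
  have h8 : C * q * G ≤ C * q * F := by gcongr
  have h9 : 0 ≤ C * B * (q * F) := by positivity
  have h10 : 0 ≤ C * (1 / n * M) := by positivity
  linarith

end Moments

/-! ### The variational inequality for the center of mass -/

section CenterOfMass

variable {Y : Type*} [MetricSpace Y] {p c : ℝ}

theorem FinProb.integral_mono {X : Type*} (σ : FinProb X) {g h : X → ℝ} (hgh : ∀ x, g x ≤ h x) :
    σ.integral g ≤ σ.integral h :=
  Finset.sum_le_sum fun u _ => mul_le_mul_of_nonneg_left (hgh u) (σ.nonneg u)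

theorem FinProb.integral_add {X : Type*} (σ : FinProb X) (g h : X → ℝ) :
    σ.integral (fun x => g x + h x) = σ.integral g + σ.integral h := by
  simp only [FinProb.integral, Finsupp.sum, mul_add, Finset.sum_add_distrib]

theorem FinProb.integral_mul {X : Type*} (σ : FinProb X) (a : ℝ) (g : X → ℝ) :
    σ.integral (fun x => a * g x) = a * σ.integral g := by
  simp only [FinProb.integral, Finsupp.sum, Finset.mul_sum]
  exact Finset.sum_congr rfl fun _ _ => by ring

theorem FinProb.integral_const {X : Type*} (σ : FinProb X) (a : ℝ) :
    σ.integral (fun _ => a) = a := by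
  have h : ∑ u ∈ σ.weights.support, σ.weights u = 1 := σ.total
  simp only [FinProb.integral, Finsupp.sum]
  rw [← Finset.sum_mul, h, one_mul]

theorem FinProb.integral_map {X Z : Type*} (σ : FinProb X) (f : X → Z) (g : Z → ℝ) :
    FinProb.integral (σ.map f) g = σ.integral fun x => g (f x) := by
  simp only [FinProb.integral, Convexity.StdSimplex.map]
  rw [Finsupp.sum_mapDomain_index (fun _ => zero_mul _) (fun _ _ _ => add_mul _ _ _)]

theorem FinProb.integral_nonneg {X : Type*} (σ : FinProb X) {g : X → ℝ} (hg : ∀ x, 0 ≤ g x) :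
    0 ≤ σ.integral g :=
  Finset.sum_nonneg fun u _ => mul_nonneg (σ.nonneg u) (hg u)

theorem integral_dist_centerOfMass_le [CompleteSpace Y] (hp : 2 ≤ p) (hc : 0 < c)
    (hY : IsUniformlyConvex Y p c) (σ : FinProb Y) (z : Y) :
    (σ.integral fun u => dist (centerOfMass p σ) u ^ p) ≤ σ.integral fun u => dist z u ^ p := by
  have hp0 : 0 < p := by linarith
  have h : ∀ z, distP p σ (centerOfMass p σ) ≤ distP p σ z :=
    @Classical.epsilon_spec Y (fun y => ∀ z, distP p σ y ≤ distP p σ z)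
      (existsUnique_isCenterOfMass hp hc hY σ).exists
  have h0 : ∀ w, 0 ≤ σ.integral fun u => dist u w ^ p := fun w =>
    σ.integral_nonneg fun u => Real.rpow_nonneg dist_nonneg _
  have h1 := (Real.rpow_le_rpow_iff (h0 _) (h0 z) (by positivity)).1 (h z)
  have h2 : ∀ w : Y, (fun u => dist w u ^ p) = fun u => dist u w ^ p := fun w =>
    funext fun u => by rw [dist_comm]
  rw [h2, h2]
  exact h1

/-- Compare the minimizer with the point at parameter `t` on a geodesic to `z`, integrate uniform
convexity, divide by `t` and let `t → 0`. -/
theorem integral_dist_centerOfMass_add_le [CompleteSpace Y] (hp : 2 ≤ p) (hc : 0 < c)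
    (hY : IsUniformlyConvex Y p c) (σ : FinProb Y) (z : Y) :
    c ^ p * dist (centerOfMass p σ) z ^ p + (σ.integral fun u => dist (centerOfMass p σ) u ^ p) ≤
      σ.integral fun u => dist z u ^ p := by
  set y := centerOfMass p σ with hy
  set F : Y → ℝ := fun w => σ.integral fun u => dist w u ^ p with hF
  change c ^ p * dist y z ^ p + F y ≤ F z
  obtain ⟨γ, a, b, hγ⟩ := hY.geodesic y z
  have key : ∀ t ∈ Set.Ioc (0 : ℝ) 1, F y + c ^ p * (1 - t) * dist y z ^ p ≤ F z := by
    intro t ht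
    have h1 : F y ≤ F (γ ((1 - t) * a + t * b)) :=
      integral_dist_centerOfMass_le hp hc hY σ _
    have h2 : F (γ ((1 - t) * a + t * b)) ≤ σ.integral fun u => (1 - t) * dist y u ^ p +
        (t * dist z u ^ p + -(c ^ p * (t * (1 - t)) * dist y z ^ p)) := by
      refine σ.integral_mono fun u => ?_
      have := hY.convex u y z γ a b hγ t ⟨ht.1.le, ht.2⟩
      rw [dist_comm _ u, dist_comm y u, dist_comm z u]
      linarith
    rw [FinProb.integral_add, FinProb.integral_add, FinProb.integral_mul, FinProb.integral_mul,
      FinProb.integral_const] at h2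
    change _ ≤ (1 - t) * F y + (t * F z + _) at h2
    refine le_of_mul_le_mul_left ?_ ht.1
    linarith
  have hlim : Filter.Tendsto (fun t : ℝ => F y + c ^ p * (1 - t) * dist y z ^ p)
      (nhdsWithin 0 (Set.Ioi 0)) (nhds (F y + c ^ p * (1 - 0) * dist y z ^ p)) := by
    refine Filter.Tendsto.mono_left (Continuous.tendsto ?_ 0) nhdsWithin_le_nhds
    fun_prop
  have hfin := le_of_tendsto hlim
    (Filter.eventually_of_mem (Ioc_mem_nhdsGT one_pos) fun t ht => key t ht)
  linarith

end CenterOfMass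

/-! ### The operator of a random walk -/

namespace RandomWalk

variable {X : Type*}

/-- The averaging operator `g ↦ (x ↦ ∫ g dμ_x)` of a random walk. -/
def op (μ : RandomWalk X) : Module.End ℝ (X → ℝ) where
  toFun g x := (μ x).integral g
  map_add' g h := funext fun x => (μ x).integral_add g h
  map_smul' a g := funext fun x => (μ x).integral_mul a g

theorem op_apply (μ : RandomWalk X) (g : X → ℝ) (x : X) : op μ g x = (μ x).integral g := rfl

theorem isMarkov_op (μ : RandomWalk X) : IsMarkov (op μ) where
  nonneg _ hg x := (μ x).integral_nonneg hg
  one := funext fun x => (μ x).integral_const 1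

theorem op_pow (μ : RandomWalk X) (n : ℕ) : op (μ.pow n) = op μ ^ n := by
  induction n with
  | zero =>
    ext g x
    simp [op_apply, RandomWalk.pow, FinProb.integral]
  | succ n ih =>
    refine LinearMap.ext fun g => funext fun x => ?_
    rw [_root_.pow_succ, Module.End.mul_apply, ← ih]
    simp only [op_apply, RandomWalk.pow, FinProb.integral,
      Convexity.StdSimplex.weights_iConvexComb]
    rw [Finsupp.sum_sum_index (fun _ => zero_mul _) (fun _ _ _ => add_mul _ _ _)]
    refine Finset.sum_congr rfl fun y _ => ?_
    change ((μ.pow n x).weights y • (μ y).weights).sum (fun x w => w * g x) =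
      (μ.pow n x).weights y * (μ y).weights.sum fun x w => w * g x
    rw [Finsupp.sum_smul_index (fun _ => zero_mul _), Finsupp.mul_sum]
    exact Finset.sum_congr rfl fun _ _ => mul_assoc _ _ _

end RandomWalk

/-! ### The standard walk: translation invariance and holding probability -/

section Cayley

variable {Γ : Type*} [Group Γ] (S : Finset Γ) (hS : S.Nonempty)

theorem op_cayleyWalk (g : Γ → ℝ) (x : Γ) :
    RandomWalk.op (cayleyWalk S hS) g x = (S.card : ℝ)⁻¹ * ∑ s ∈ S, g (x * s) := by
  simp only [RandomWalk.op_apply, FinProb.integral, cayleyWalk]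
  rw [← Finsupp.sum_finsetSum_index (fun _ => zero_mul _) (fun _ _ _ => add_mul _ _ _),
    Finset.mul_sum]
  exact Finset.sum_congr rfl fun s _ => Finsupp.sum_single_index (zero_mul _)

/-- The walk multiplies on the right, and left and right multiplications commute. -/
theorem commute_op_cayleyWalk_funLeft (a : Γ) :
    Commute (RandomWalk.op (cayleyWalk S hS)) (LinearMap.funLeft ℝ ℝ (a * ·)) := by
  refine LinearMap.ext fun g => funext fun x => ?_
  simp only [Module.End.mul_apply, LinearMap.funLeft_apply, op_cayleyWalk, mul_assoc]

/-- The return probability of an even number of steps is at least `|S|⁻¹` to that number. -/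
theorem smul_le_op_cayleyWalk_pow (hsymm : ∀ s ∈ S, s⁻¹ ∈ S) {j : ℕ} (hj : Even j)
    (g : Γ → ℝ) (hg : 0 ≤ g) :
    ((S.card : ℝ)⁻¹ ^ j) • g ≤ (RandomWalk.op (cayleyWalk S hS) ^ j) g := by
  set T := RandomWalk.op (cayleyWalk S hS) with hT
  have hTm : IsMarkov T := RandomWalk.isMarkov_op _
  set e : ℝ := (S.card : ℝ)⁻¹ with he
  have he0 : 0 ≤ e := by positivity
  have htwo : ∀ g : Γ → ℝ, 0 ≤ g → (e ^ 2) • g ≤ (T ^ 2) g := by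
    intro g hg x
    obtain ⟨s, hs⟩ := id hS
    have hone : ∀ h : Γ → ℝ, 0 ≤ h → ∀ y, ∀ s ∈ S, e * h (y * s) ≤ T h y := by
      intro h hh y s hs
      rw [hT, op_cayleyWalk]
      exact mul_le_mul_of_nonneg_left
        (Finset.single_le_sum (f := fun s => h (y * s)) (fun _ _ => hh _) hs) he0
    rw [pow_two T, Module.End.mul_apply]
    have h1 := hone (T g) (hTm.nonneg g hg) x s hs
    -- Return to `x` by stepping along `s` and back along `s⁻¹`.
    have h2 := mul_le_mul_of_nonneg_left (hone g hg (x * s) s⁻¹ (hsymm s hs)) he0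
    rw [mul_inv_cancel_right] at h2
    simp only [Pi.smul_apply, smul_eq_mul]
    linarith
  obtain ⟨i, rfl⟩ := hj
  rw [← two_mul, pow_mul, pow_mul]
  have hT2 := hTm.pow 2
  induction i with
  | zero => simp
  | succ i ih =>
    rw [pow_succ' (T ^ 2), Module.End.mul_apply]
    refine le_trans ?_ (hT2.mono ih)
    rw [map_smul, pow_succ, mul_smul]
    exact smul_le_smul_of_nonneg_left (htwo g hg) (by positivity)

end Cayley

/-! ### Energy in terms of the walk operator -/

theorem gradP_rpow {X Y : Type*} [MetricSpace Y] {p : ℝ} (hp : p ≠ 0) (μ : RandomWalk X)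
    (f : X → Y) (x : X) :
    gradP p μ f x ^ p = RandomWalk.op μ (fun z => dist (f x) (f z) ^ p) x := by
  have h0 : 0 ≤ (μ x).integral fun x' => dist (f x) (f x') ^ p :=
    (μ x).integral_nonneg fun u => Real.rpow_nonneg dist_nonneg _
  rw [gradP, ← Real.rpow_mul h0, one_div_mul_cancel hp, Real.rpow_one]
  rfl

theorem energy_eq {Γ Y : Type*} [Group Γ] [MetricSpace Y] {p : ℝ} (hp : p ≠ 0)
    (μ : RandomWalk Γ) (f : Γ → Y) :
    energy p μ f = 1 / 2 * RandomWalk.op μ (fun z => dist (f 1) (f z) ^ p) 1 := by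
  rw [energy, gradP_rpow hp]

theorem energy_nonneg {Γ Y : Type*} [Group Γ] [MetricSpace Y] {p : ℝ} (hp : p ≠ 0)
    (μ : RandomWalk Γ) (f : Γ → Y) : 0 ≤ energy p μ f := by
  rw [energy_eq hp]
  have := (RandomWalk.isMarkov_op μ).nonneg (fun z => dist (f 1) (f z) ^ p)
    (fun z => Real.rpow_nonneg dist_nonneg _) 1
  change 0 ≤ RandomWalk.op μ (fun z => dist (f 1) (f z) ^ p) 1 at this
  positivity

/-! ### Energy of the average of an equivariant function -/

section Equivariant

variable {Γ Y : Type*} [Group Γ] [MetricSpace Y] [MulAction Γ Y] [IsIsometricSMul Γ Y] {p c : ℝ}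

theorem IsEquivariant.apply_dist_rpow {P : Module.End ℝ (Γ → ℝ)}
    (hP : ∀ a : Γ, Commute P (LinearMap.funLeft ℝ ℝ (a * ·))) {f : Γ → Y}
    (hf : IsEquivariant f) (w : Y) (a : Γ) :
    P (fun z => dist w (f z) ^ p) a = P (fun z => dist (a⁻¹ • w) (f z) ^ p) 1 := by
  have h := congrFun (LinearMap.congr_fun (hP a) fun z => dist w (f z) ^ p) 1
  simp only [Module.End.mul_apply, LinearMap.funLeft_apply, mul_one] at h
  rw [← h]
  refine congrFun (congrArg P (funext fun z => ?_)) 1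
  rw [LinearMap.funLeft_apply, hf, ← dist_smul a (a⁻¹ • w), smul_inv_smul]

/-- The energy of the average is controlled by the effect of one more step of the walk. -/
theorem energy_average_le [CompleteSpace Y] (hp : 2 ≤ p) (hc : 0 < c)
    (hY : IsUniformlyConvex Y p c) {f : Γ → Y} (hf : IsEquivariant f) {μ : RandomWalk Γ}
    (hμ : ∀ a : Γ, Commute (RandomWalk.op μ) (LinearMap.funLeft ℝ ℝ (a * ·))) (n : ℕ) :
    2 * c ^ p * energy p μ (average p (μ.pow n) f) +
        (RandomWalk.op μ ^ n) (fun z => dist (average p (μ.pow n) f 1) (f z) ^ p) 1 ≤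
      (RandomWalk.op μ ^ (n + 1)) (fun z => dist (average p (μ.pow n) f 1) (f z) ^ p) 1 := by
  set P := RandomWalk.op μ with hPdef
  set A := average p (μ.pow n) f with hA
  have hPm : IsMarkov P := RandomWalk.isMarkov_op μ
  have hPn : ∀ a : Γ, Commute (P ^ n) (LinearMap.funLeft ℝ ℝ (a * ·)) := fun a =>
    (hμ a).pow_left n
  have hint : ∀ (w : Y) (x : Γ), FinProb.integral ((μ.pow n x).map f) (fun u => dist w u ^ p) =
      (P ^ n) (fun z => dist w (f z) ^ p) x := fun w x => by
    rw [FinProb.integral_map, hPdef, ← RandomWalk.op_pow]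
    rfl
  set m := (P ^ n) (fun z => dist (A 1) (f z) ^ p) 1 with hm
  -- Translate `x` to `1`: there `x⁻¹ • A x` competes with the minimizer `A 1`. Equivariance of `A`
  -- itself is not needed.
  have hmin : ∀ x, m ≤ (P ^ n) (fun z => dist (A x) (f z) ^ p) x := by
    intro x
    rw [hf.apply_dist_rpow hPn, ← hint, hm, ← hint]
    exact integral_dist_centerOfMass_le hp hc hY _ _
  have hvar : ∀ x, c ^ p * dist (A 1) (A x) ^ p + m ≤
      (P ^ n) (fun z => dist (A 1) (f z) ^ p) x := by
    intro x
    rw [dist_comm, ← hint]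
    refine le_trans ?_ (integral_dist_centerOfMass_add_le hp hc hY ((μ.pow n x).map f) (A 1))
    have := hmin x
    rw [← hint] at this
    exact add_le_add_right this _
  rw [energy_eq (by linarith)]
  -- Average over one step `x` from `1`; the right side becomes `P^(n+1)`.
  have hstep := hPm.mono (g := (c ^ p) • (fun x => dist (A 1) (A x) ^ p) + fun _ => m) hvar 1
  rw [map_add, map_smul, hPm.const] at hstep
  rw [pow_succ', Module.End.mul_apply]
  refine le_trans (le_of_eq ?_) hstep
  simp only [Pi.add_apply, Pi.smul_apply, smul_eq_mul]
  ring

end Equivariant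

end UniformlyConvexAveraging

open UniformlyConvexAveraging
theorem mainTheorem5 (p c : ℝ) (hp : 2 ≤ p) (hc : 0 < c) (d j : ℕ) (hj : Even j) :
    ∃ C : ℝ, 0 < C ∧
      ∀ (Γ : Type u) [Group Γ] (S : Finset Γ) (hS : S.Nonempty),
        (∀ s ∈ S, s⁻¹ ∈ S) → (1 : Γ) ∉ S → S.card = 2 * d →
        Subgroup.closure (S : Set Γ) = ⊤ →
      ∀ (Y : Type v) [MetricSpace Y] [CompleteSpace Y] [MulAction Γ Y] [IsIsometricSMul Γ Y],
        IsUniformlyConvex Y p c →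
      ∀ f : Γ → Y, IsEquivariant f →
      ∀ μ : RandomWalk Γ, μ = (cayleyWalk S hS).pow j →
      ∀ n : ℕ, 1 ≤ n →
        energy p μ (average p (μ.pow n) f) ≤
          C * (Real.sqrt (Real.log n / n) * energy p (μ.pow n) f
            + 1 / n * energy p μ f) := by
  have hp0 : p ≠ 0 := by linarith
  rcases Nat.eq_zero_or_pos d with rfl | hd
  · refine ⟨1, one_pos, fun Γ _ S hS _ _ hcard => ?_⟩
    exact absurd hcard hS.card_pos.ne'
  -- For `j = 0` the holding bound would be `ε = 1`, which leaves no `K`; but then `μ` never moves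
  -- and the left side vanishes.
  rcases Nat.eq_zero_or_pos j with rfl | hj0
  · refine ⟨1, one_pos, fun Γ _ S hS _ _ _ _ Y _ _ _ _ _ f _ μ hμ n _ => ?_⟩
    have h0 : energy p μ (average p (μ.pow n) f) = 0 := by
      rw [energy_eq hp0, hμ, RandomWalk.op_pow, pow_zero]
      simp [Real.zero_rpow hp0]
    have h1 := energy_nonneg hp0 (μ.pow n) f
    have h2 := energy_nonneg hp0 μ f
    rw [h0]
    positivity
  have hd2 : (1 : ℝ) < ((2 * d : ℕ) : ℝ) := by exact_mod_cast (by omega : 1 < 2 * d)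
  have hε0 : 0 < (((2 * d : ℕ) : ℝ)⁻¹) ^ j := by positivity
  have hε1 : (((2 * d : ℕ) : ℝ)⁻¹) ^ j < 1 :=
    pow_lt_one₀ (by positivity) (inv_lt_one_of_one_lt₀ hd2) hj0.ne'
  obtain ⟨C, hC, hlazy⟩ := exists_lazy_pow_succ_le.{u, v} (p := p) (by linarith) hε0 hε1
  have hcp : 0 < c ^ p := Real.rpow_pos_of_pos hc p
  -- The factor `2` in front of each of the three energies cancels.
  refine ⟨C / c ^ p, by positivity, ?_⟩
  intro Γ _ S hS hsymm _ hcard _ Y _ _ _ _ hY f hf μ hμ n hn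
  have hop : RandomWalk.op μ = RandomWalk.op (cayleyWalk S hS) ^ j := by
    rw [hμ, RandomWalk.op_pow]
  have hcomm : ∀ a : Γ, Commute (RandomWalk.op μ) (LinearMap.funLeft ℝ ℝ (a * ·)) := fun a => by
    rw [hop]
    exact (commute_op_cayleyWalk_funLeft S hS a).pow_left j
  have hle := energy_average_le hp hc hY hf hcomm n
  have hholding : ∀ g : Γ → ℝ, 0 ≤ g →
      ((((2 * d : ℕ) : ℝ)⁻¹) ^ j) • g ≤ RandomWalk.op μ g := fun g hg => by
    rw [hop, ← hcard]
    exact smul_le_op_cayleyWalk_pow S hS hsymm hj g hg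
  have hgrad : ∀ x, RandomWalk.op μ (fun z => dist (f x) (f z) ^ p) x ≤ 2 * energy p μ f := by
    intro x
    rw [hf.apply_dist_rpow hcomm, ← hf, inv_mul_cancel, energy_eq hp0]
    linarith
  have hint : ∀ w : Y, FinProb.integral ((μ.pow n 1).map f) (fun u => dist w u ^ p) =
      (RandomWalk.op μ ^ n) (fun z => dist w (f z) ^ p) 1 := fun w => by
    rw [FinProb.integral_map, ← RandomWalk.op_pow]
    rfl
  have hw : (RandomWalk.op μ ^ n) (fun z => dist (average p (μ.pow n) f 1) (f z) ^ p) 1 ≤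
      (RandomWalk.op μ ^ n) (fun z => dist (f 1) (f z) ^ p) 1 := by
    rw [← hint, ← hint]
    exact integral_dist_centerOfMass_le hp hc hY _ _
  have hmain := hlazy Γ Y _ (RandomWalk.isMarkov_op μ) hholding f _ hgrad n hn _ 1 hw
  have hEn : (RandomWalk.op μ ^ n) (fun z => dist (f 1) (f z) ^ p) 1 =
      2 * energy p (μ.pow n) f := by
    rw [energy_eq hp0, RandomWalk.op_pow]
    ring
  rw [hEn] at hmain
  rw [div_mul_eq_mul_div, le_div_iff₀ hcp]
  linarith
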